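/- Let $K$ be a number field with ring of integers $\mathcal{O}_K$, group of roots of unity $\mu_K$, set of infinite places $\Omega_\infty$ and set of all places $\Omega_K$, with normalized absolute values $|\cdot|_v:=|N_{K_v|\mathbb{Q}_w}(\cdot)|_w$ for $v$ above $w$. Let $S\subset\mathbb{P}^4_K$ be the surface $$x_0x_3-x_2x_4=x_0x_1+x_1x_3+x_2^2=0,$$ let $U$ be the complement in $S$ of the lines contained in $S$ (over an algebraic closure of $K$), let $H(x_0:\cdots:x_4)=\prod_{v\in\Omega_K}\max_i|x_i|_v$, and for $B\in\mathbb{R}$ let $N_{U,H}(B)=|\{x\in U(K): H(x)\le B\}|$. Let $\mathcal{C}$ be a set of nonzero integral ideals of $\mathcal{O}_K$ containing exactly one ideal from each ideal class, and let $U_K\subseteq\mathcal{O}_K^\times$ be the subgroup generated by a system of fundamental units. Put $$\begin{aligned} m^{(1)}&=(0,0,0,0,0,1),& m^{(2)}&=(0,0,0,0,1,0),& m^{(3)}&=(0,1,-1,0,0,0),\\ m^{(4)}&=(0,0,1,-1,0,0),& m^{(5)}&=(0,0,0,1,0,0),& m^{(6)}&=(1,-1,0,0,-1,-1),\\ m^{(7)}&=(1,-1,-1,-1,0,0),&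 m^{(8)}&=(1,0,0,0,-1,0),& m^{(9)}&=(1,0,0,0,0,-1), \end{aligned}$$ and write $\underline{t}^{m}=t_0^{m_0}\cdots t_5^{m_5}$ for a tuple $\underline t=(t_0,\dots,t_5)$ of units or of ideals and $m=(m_0,\dots,m_5)\in\mathbb{Z}^6$. Let $\mathcal{F}$ be any fundamental domain (a set containing exactly one element of each orbit) for the action of $U_K\times(\mathcal{O}_K^\times)^5$ on $(K^\times)^7\times K^2$ in which $\underline{u}=(u_0,\dots,u_5)$ maps $(a_1,\dots,a_9)$ to $(\underline{u}^{m^{(1)}}a_1,\dots,\underline{u}^{m^{(9)}}a_9)$. For $\underline{c}=(c_0,\dots,c_5)\in\mathcal{C}^6$ let $\mathcal{O}_j=\underline{c}^{m^{(j)}}$ for $1\le j\le 9$ and let $u_{\underline c}=\mathfrak{N}(c_0^3c_1^{-1}\cdots c_5^{-1})$. For $v\in\Omega_\infty$ and $a_1,\dots,a_8\in K$ with $a_1\ne0$, let $\tilde N_v(a_1,\dots,a_8)$ be the maximum of the $|\cdot|_v$-values of the five elements $$a_2a_3a_4a_5a_6a_7a_8,\quad a_1^2a_2^2a_3^2a_4a_6^3,\quad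 a_1a_2a_3^2a_4^2a_5^2a_6^2a_7,$$ $$a_3a_4a_5a_6a_7(a_3a_4^2a_5^3a_7+a_2a_8),\quad \frac{a_2a_7a_8^2+a_3a_4^2a_5^3a_7^2a_8}{a_1}.$$ Let $M_{\underline{c}}(B)$ be the set of all $(a_1,\dots,a_9)\in\mathcal{F}$ with $a_j\in\mathcal{O}_j$ for $1\le j\le 9$ and $a_j\neq0$ for $1\le j\le7$ that satisfy - the height condition $\prod_{v\in\Omega_\infty}\tilde N_v(a_1,\dots,a_8)\le u_{\underline c}B$; - the torsor equation $a_1a_9+a_2a_8+a_3a_4^2a_5^3a_7=0$; - the coprimality conditions $a_j\mathcal{O}_j^{-1}+a_k\mathcal{O}_k^{-1}=\mathcal{O}_K$ for all $1\le j<k\le 9$ that are not adjacent in the graph with vertices $1,\dots,9$ and edges $\{1,6\}$, $\{1,9\}$, $\{2,6\}$, $\{2,8\}$, $\{3,4\}$, $\{3,6\}$, $\{4,5\}$, $\{5,7\}$, $\{7,8\}$, $\{7,9\}$, $\{8,9\}$. Then, for every $B\in\mathbb{R}$, the set $\{x\in U(K): H(x)\le B\}$ and all the sets $M_{\underline{c}}(B)$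 are finite, and $$N_{U,H}(B)=\frac{1}{|\mu_K|}\sum_{\underline{c}\in\mathcal{C}^6}|M_{\underline{c}}(B)|.$$ -/

import Mathlib

open scoped NumberField nonZeroDivisors BigOperators

namespace A3A1

noncomputable section

/-! ### The surface `S`, the open subset `U` and the counting function -/

/-- The vector `x = (x_0, …, x_4)` satisfies the two quadratic equations defining the surface
`S` in projective 4-space. -/
def OnSurface {F : Type*} [CommRing F] (x : Fin 5 → F) : Prop :=
  x 0 * x 3 - x 2 * x 4 = 0 ∧ x 0 * x 1 + x 1 * x 3 + x 2 ^ 2 = 0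

/-- A two-dimensional linear subspace `W` of `F ^ 5`, viewed as a line in projective 4-space, that
is contained in `S`. (We use this for algebraically closed `F` only.) -/
def IsLineInSurface {F : Type*} [Field F] (W : Submodule F (Fin 5 → F)) : Prop :=
  Module.finrank F W = 2 ∧ ∀ w ∈ W, OnSurface w

/-- `U(K)`: the `K`-rational points of `S` that lie on none of the lines contained in `S`
(lines over the algebraic closure of `K`). -/
def pointsU (K : Type*) [Field K] : Set (Projectivization K (Fin 5 → K)) :=
  {P | OnSurface P.rep ∧
    ∀ W : Submodule (AlgebraicClosure K) (Fin 5 → AlgebraicClosure K), IsLineInSurface W →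
      (fun i => algebraMap K (AlgebraicClosure K) (P.rep i)) ∉ W}

/-- The points of `U(K)` of height at most `B`. Here `Projectivization.mulHeight` is the Weil height
relative to `K`, that is, the product over all places `v` of `max_i |x_i|_v`, where the absolute
value at an infinite place enters with the local degree as exponent. -/
def boundedPointsU (K : Type*) [Field K] [NumberField K] (B : ℝ) :
    Set (Projectivization K (Fin 5 → K)) :=
  {P | P ∈ pointsU K ∧ P.mulHeight ≤ B}

/-- The counting function `N_{U,H}(B)`. -/
def countingFunction (K : Type*) [Field K] [NumberField K] (B : ℝ) : ℕ :=
  (boundedPointsU K B).ncard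

/-! ### Combinatorial data

Nine-tuples `(a_1, …, a_9)` are functions on `Fin 9`, so that `a_j` is the value at `j - 1`.
Six-tuples `(c_0, …, c_5)` are functions on `Fin 6` without a shift. -/

/-- The degrees `m^{(1)}, …, m^{(9)}` in `ℤ ^ 6`. -/
def degree : Fin 9 → Fin 6 → ℤ :=
  ![![0, 0, 0, 0, 0, 1],
    ![0, 0, 0, 0, 1, 0],
    ![0, 1, -1, 0, 0, 0],
    ![0, 0, 1, -1, 0, 0],
    ![0, 0, 0, 1, 0, 0],
    ![1, -1, 0, 0, -1, -1],
    ![1, -1, -1, -1, 0, 0],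
    ![1, 0, 0, 0, -1, 0],
    ![1, 0, 0, 0, 0, -1]]

/-- The edges of the extended Dynkin diagram, with the vertices `E_1, …, E_9` written as
`1, …, 9`. -/
def edges : List (ℕ × ℕ) :=
  [(1, 6), (1, 9), (2, 6), (2, 8), (3, 4), (3, 6), (4, 5), (5, 7), (7, 8), (7, 9), (8, 9)]

/-- Adjacency in the diagram of the vertices with indices `j` and `k` (shifted by one). -/
def Adjacent (j k : Fin 9) : Prop :=
  (j.val + 1, k.val + 1) ∈ edges ∨ (k.val + 1, j.val + 1) ∈ edges

section Field

variable {K : Type*} [Field K]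

/-- The torsor equation `a_1 a_9 + a_2 a_8 + a_3 a_4^2 a_5^3 a_7 = 0`. -/
def TorsorEquation (a : Fin 9 → K) : Prop :=
  a 0 * a 8 + a 1 * a 7 + a 2 * a 3 ^ 2 * a 4 ^ 3 * a 6 = 0

/-- The subset `(Kˣ) ^ 7 × K ^ 2` of `K ^ 9`. -/
def torsorSpace (K : Type*) [Field K] : Set (Fin 9 → K) :=
  {a | ∀ j : Fin 9, j.val < 7 → a j ≠ 0}

/-- The five expressions in `(x_1, …, x_8)` whose maximal `v`-adic absolute value is
`Ñ_v(x_1, …, x_8)`. -/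
def heightForms (x : Fin 8 → K) : Fin 5 → K :=
  ![x 1 * x 2 * x 3 * x 4 * x 5 * x 6 * x 7,
    x 0 ^ 2 * x 1 ^ 2 * x 2 ^ 2 * x 3 * x 5 ^ 3,
    x 0 * x 1 * x 2 ^ 2 * x 3 ^ 2 * x 4 ^ 2 * x 5 ^ 2 * x 6,
    x 2 * x 3 * x 4 * x 5 * x 6 * (x 2 * x 3 ^ 2 * x 4 ^ 3 * x 6 + x 1 * x 7),
    (x 1 * x 6 * x 7 ^ 2 + x 2 * x 3 ^ 2 * x 4 ^ 3 * x 6 ^ 2 * x 7) / x 0]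

/-- The value `Ñ_v(σ_v(x_1, …, x_8))` for an infinite place `v` of `K`: the maximum of the normalized
absolute values `|·|_v` (the usual one for real `v`, its square for complex `v`) of the five
expressions. -/
def nTilde (v : NumberField.InfinitePlace K) (x : Fin 8 → K) : ℝ :=
  ⨆ i : Fin 5, (v (heightForms x i)) ^ v.mult

end Field

section NumberField

variable {K : Type*} [Field K] [NumberField K]

/-- The family `ε` is a system of fundamental units: every unit is, in exactly one way, the product
of a root of unity and integral powers of the members of `ε`. -/
def IsFundamentalSystem (ε : Fin (NumberField.Units.rank K) → (𝓞 K)ˣ) : Prop :=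
  ∀ u : (𝓞 K)ˣ, ∃! p : NumberField.Units.torsion K × (Fin (NumberField.Units.rank K) → ℤ),
    u = (p.1 : (𝓞 K)ˣ) * ∏ i, ε i ^ p.2 i

/-- The action of `(𝓞 K)ˣ ^ 6` on `K ^ 9`, in which the `j`-th coordinate is multiplied by
`u ^ m^{(j)}`. -/
def unitAction (u : Fin 6 → (𝓞 K)ˣ) (a : Fin 9 → K) : Fin 9 → K :=
  fun j => (((∏ i, u i ^ degree j i : (𝓞 K)ˣ) : 𝓞 K) : K) * a j

/-- For a subgroup `V` of the units, the set `D` is a fundamental domain for the action of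
`V × (𝓞 K)ˣ ^ 5` on `(Kˣ) ^ 7 × K ^ 2`: it contains exactly one element of each orbit. -/
def IsFundamentalDomain (V : Subgroup (𝓞 K)ˣ) (D : Set (Fin 9 → K)) : Prop :=
  D ⊆ torsorSpace K ∧
    ∀ a ∈ torsorSpace K, ∃! b, b ∈ D ∧ ∃ u : Fin 6 → (𝓞 K)ˣ, u 0 ∈ V ∧ b = unitAction u a

variable (K) in
/-- The fractional ideal `c ^ m = c_0 ^ {m_0} ⋯ c_5 ^ {m_5}`. -/
def idealPow (c : Fin 6 → (Ideal (𝓞 K))⁰) (m : Fin 6 → ℤ) : FractionalIdeal (𝓞 K)⁰ K :=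
  ∏ i, (((c i : Ideal (𝓞 K)) : FractionalIdeal (𝓞 K)⁰ K)) ^ m i

/-- `u_c`, the norm of `c_0 ^ 3 c_1 ^ {-1} ⋯ c_5 ^ {-1}`. -/
def uNorm (c : Fin 6 → (Ideal (𝓞 K))⁰) : ℚ :=
  FractionalIdeal.absNorm (idealPow K c ![3, -1, -1, -1, -1, -1])

/-- The ideal `a_j 𝒪_j ^ {-1}`, where `𝒪_j = c ^ {m^{(j)}}`. -/
def coordIdeal (c : Fin 6 → (Ideal (𝓞 K))⁰) (a : Fin 9 → K) (j : Fin 9) :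
    FractionalIdeal (𝓞 K)⁰ K :=
  FractionalIdeal.spanSingleton (𝓞 K)⁰ (a j) * (idealPow K c (degree j))⁻¹

/-- The coprimality conditions: the ideals attached to distinct nonadjacent vertices are coprime. -/
def Coprimality (c : Fin 6 → (Ideal (𝓞 K))⁰) (a : Fin 9 → K) : Prop :=
  ∀ j k : Fin 9, j ≠ k → ¬ Adjacent j k → coordIdeal c a j + coordIdeal c a k = 1

/-- The height condition, in terms of `a_1, …, a_8`. -/
def HeightCondition (c : Fin 6 → (Ideal (𝓞 K))⁰) (B : ℝ) (a : Fin 9 → K) : Prop :=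
  ∏ v : NumberField.InfinitePlace K, nTilde v (fun j : Fin 8 => a j.castSucc) ≤ (uNorm c : ℝ) * B

/-- The set `M_c(B)`, with respect to the set `D` (a fundamental domain). -/
def torsorPoints (D : Set (Fin 9 → K)) (c : Fin 6 → (Ideal (𝓞 K))⁰) (B : ℝ) :
    Set (Fin 9 → K) :=
  {a | (∀ j, a j ∈ idealPow K c (degree j)) ∧ (∀ j : Fin 9, j.val < 7 → a j ≠ 0) ∧ a ∈ D ∧
    HeightCondition c B a ∧ TorsorEquation a ∧ Coprimality c a}

end NumberField

end

end A3A1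

/-! The lines of `S` sweep out exactly `x_2 = 0` on `S`, so `U(K)` consists of the points `(s :
-1/(s+t) : 1 : t : st)` with `s + t ≠ 0` (`mem_pointsU_iff`, `exists_eq_mk_surfacePoint`). The
torsor points above such a point are the translates of `(1,1,1,1,1,1,-(s+t),s,t)` by tuples `z` of
six nonzero elements, and `z` is determined by the translate.

The core is a statement about ideals. Nonzero fractional ideals under sum and product, together with
zero, form an idempotent semifield. There the coprimality conditions have exactly one solution `d`
over given `s`, `t` (`exists_graphCoprime`, `eq_of_graphCoprime`): the `d i` are successive gcds, as
for a blow-up of the plane in five points, some infinitely near. Writing `d i` as a principal ideal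
`(z i)` over a class representative `c i` fixes `c i`, and fixes `z i` up to a unit. Hence above
each point of `U(K)` the coprime torsor points form one free orbit of the six-fold unit group, for a
single `c` (`exists_torsor_orbit`). Restricting the first unit to the subgroup of fundamental units
splits this orbit into one orbit per root of unity, which accounts for the factor `1/|μ_K|`.

For the height, the same coprimality makes the five monomials generate the unit ideal
(`GraphCoprime.sum_monomials`). The finite places therefore contribute exactly the inverse of `uNorm
c`, and the height condition becomes `H(x) ≤ B` (`heightCondition_iff`). -/

namespace A3A1

/-! ### Coprimality in an idempotent semifield -/

section Idempotent

variable {F : Type*} [Semifield F]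

/-- The coprimality conditions for nine elements of an idempotent semifield. -/
def GraphCoprime (I : Fin 9 → F) : Prop :=
  ∀ j k : Fin 9, j ≠ k → ¬ Adjacent j k → I j + I k = 1

/-- The point with coordinates `d` in the torus acts on the torsor by the characters `degree j`. -/
def torusCoord (d : Fin 6 → F) (p : Fin 9 → F) (j : Fin 9) : F :=
  (∏ i, d i ^ degree j i) * p j

theorem add_self_of_idem (h1 : (1 : F) + 1 = 1) (a : F) : a + a = a := by
  have : a * (1 + 1) = a * 1 := by rw [h1]
  simpa [mul_add] using this

theorem add_ne_zero_of_idem (h1 : (1 : F) + 1 = 1) {a : F} (ha : a ≠ 0) (b : F) : a + b ≠ 0 := by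
  intro h
  have : a + (a + b) = a + b := by rw [← add_assoc, add_self_of_idem h1]
  rw [h, add_zero] at this
  exact ha this

theorem add_one_of_add_eq_one (h1 : (1 : F) + 1 = 1) {a b : F} (h : a + b = 1) : a + 1 = 1 := by
  rw [← h, ← add_assoc, add_self_of_idem h1]

theorem coprime_mul (h1 : (1 : F) + 1 = 1) {a b c : F} (hb : a + b = 1) (hc : a + c = 1) :
    a + b * c = 1 := by
  have hc1 : 1 + c = 1 := by rw [add_comm]; exact add_one_of_add_eq_one h1 (by rwa [add_comm])
  calc a + b * c = a * (1 + c) + b * c := by rw [hc1, mul_one]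
    _ = a * 1 + (a + b) * c := by ring
    _ = 1 := by rw [hb]; simpa using hc

theorem coprime_of_mul_left {a b c : F} (hb : b + 1 = 1) (hc : c + 1 = 1)
    (h : a + b * c = 1) : a + b = 1 := by
  calc a + b = a + b * (c + 1) := by rw [hc, mul_one]
    _ = (a + b * c) + b := by ring
    _ = 1 := by rw [h, add_comm, hb]

/-- A factor coprime to `a` can be dropped from the other summand of a gcd with `a`. -/
theorem coprime_add_mul {a b c : F} (hc : a + c = 1) (hb : b + 1 = 1) :
    a + b * c = a + b := by
  have ha : 1 + b = 1 := by rw [add_comm, hb]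
  calc a + b * c = a * (1 + b) + b * c := by rw [ha, mul_one]
    _ = a + b * (a + c) := by ring
    _ = a + b := by rw [hc, mul_one]

/-- Every vertex has a nonneighbour, so integrality (`x + 1 = 1`) is implied by coprimality. -/
theorem GraphCoprime.add_one {I : Fin 9 → F} (h1 : (1 : F) + 1 = 1) (hI : GraphCoprime I)
    (j : Fin 9) : I j + 1 = 1 := by
  have : ∃ k, j ≠ k ∧ ¬ Adjacent j k := by
    unfold Adjacent edges
    revert j; decide
  obtain ⟨k, hk, hk'⟩ := this
  exact add_one_of_add_eq_one h1 (hI j k hk hk')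

theorem graphCoprime_iff {I : Fin 9 → F} : GraphCoprime I ↔
    (I 0 + I 1 = 1 ∧ I 0 + I 2 = 1 ∧ I 0 + I 3 = 1 ∧ I 0 + I 4 = 1 ∧ I 0 + I 6 = 1 ∧
      I 0 + I 7 = 1) ∧
    (I 1 + I 2 = 1 ∧ I 1 + I 3 = 1 ∧ I 1 + I 4 = 1 ∧ I 1 + I 6 = 1 ∧ I 1 + I 8 = 1) ∧
    (I 2 + I 4 = 1 ∧ I 2 + I 6 = 1 ∧ I 2 + I 7 = 1 ∧ I 2 + I 8 = 1) ∧
    (I 3 + I 5 = 1 ∧ I 3 + I 6 = 1 ∧ I 3 + I 7 = 1 ∧ I 3 + I 8 = 1) ∧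
    (I 4 + I 5 = 1 ∧ I 4 + I 7 = 1 ∧ I 4 + I 8 = 1) ∧
    (I 5 + I 6 = 1 ∧ I 5 + I 7 = 1 ∧ I 5 + I 8 = 1) := by
  constructor
  · intro h
    unfold GraphCoprime Adjacent edges at h
    refine ⟨⟨?_, ?_, ?_, ?_, ?_, ?_⟩, ⟨?_, ?_, ?_, ?_, ?_⟩, ⟨?_, ?_, ?_, ?_⟩, ⟨?_, ?_, ?_, ?_⟩,
      ⟨?_, ?_, ?_⟩, ⟨?_, ?_, ?_⟩⟩ <;> exact h _ _ (by decide) (by decide)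
  · rintro ⟨⟨h01, h02, h03, h04, h06, h07⟩, ⟨h12, h13, h14, h16, h18⟩, ⟨h24, h26, h27, h28⟩,
      ⟨h35, h36, h37, h38⟩, ⟨h45, h47, h48⟩, ⟨h56, h57, h58⟩⟩ j k hjk hadj
    unfold Adjacent edges at hadj
    wlog hlt : j < k generalizing j k
    · rw [add_comm]
      exact this k j hjk.symm (by tauto) (lt_of_le_of_ne (not_lt.mp hlt) hjk.symm)
    clear hjk
    fin_cases j <;> fin_cases k <;>
      first
      | assumption
      | exact absurd hlt (by decide)
      | exact absurd hadj (by decide)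

/-- The five monomials defining the map to the surface generate the unit ideal. -/
theorem GraphCoprime.sum_monomials {I : Fin 9 → F} (h1 : (1 : F) + 1 = 1) (hI : GraphCoprime I) :
    I 1 * I 2 * I 3 * I 4 * I 5 * I 6 * I 7 + I 0 ^ 2 * I 1 ^ 2 * I 2 ^ 2 * I 3 * I 5 ^ 3 +
      I 0 * I 1 * I 2 ^ 2 * I 3 ^ 2 * I 4 ^ 2 * I 5 ^ 2 * I 6 +
      I 0 * I 2 * I 3 * I 4 * I 5 * I 6 * I 8 + I 6 * I 7 * I 8 = 1 := by
  have hone := hI.add_one h1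
  obtain ⟨⟨h01, h02, h03, h04, h06, h07⟩, ⟨h12, h13, h14, h16, h18⟩, ⟨h24, h26, h27, h28⟩,
      ⟨h35, h36, h37, h38⟩, ⟨h45, h47, h48⟩, ⟨h56, h57, h58⟩⟩ := graphCoprime_iff.mp hI
  have C := @coprime_mul F _ h1
  have hmul : ∀ {a b : F}, a + 1 = 1 → b + 1 = 1 → a * b + 1 = 1 := by
    intro a b ha hb
    rw [add_comm] at *
    exact C ha hb
  have hpow : ∀ {a : F}, a + 1 = 1 → a ^ 2 + 1 = 1 := fun {a} ha => by rw [pow_two]; exact hmul ha ha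
  have hadd : ∀ {a b c : F}, a + b = 1 → c + 1 = 1 → a + (b + c) = 1 := by
    intro a b c h h'
    rw [← add_assoc, h, add_comm, h']
  set m0 := I 1 * I 2 * I 3 * I 4 * I 5 * I 6 * I 7 with hm0
  set m3 := I 0 * I 2 * I 3 * I 4 * I 5 * I 6 * I 8 with hm3
  set m4 := I 6 * I 7 * I 8 with hm4
  have e0 : m0 + 1 = 1 := by
    exact hmul (hmul (hmul (hmul (hmul (hmul (hone _) (hone _)) (hone _)) (hone _)) (hone _))
      (hone _)) (hone _)
  have e3 : m3 + 1 = 1 := by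
    exact hmul (hmul (hmul (hmul (hmul (hmul (hone _) (hone _)) (hone _)) (hone _)) (hone _))
      (hone _)) (hone _)
  have e4 : m4 + 1 = 1 := hmul (hmul (hone _) (hone _)) (hone _)
  have e03 : m0 + m3 + 1 = 1 := by rw [add_assoc, e3, e0]
  -- It suffices that `m4 + m0 + m3` is coprime to every factor of the second monomial. The factors
  -- `I 2`, `I 3`, `I 5` are already coprime to `m4`.
  have k2 : I 2 + (m4 + (m0 + m3)) = 1 := hadd (C (C h26 h27) h28) e03
  have k3 : I 3 + (m4 + (m0 + m3)) = 1 := hadd (C (C h36 h37) h38) e03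
  have k5 : I 5 + (m4 + (m0 + m3)) = 1 := hadd (C (C h56 h57) h58) e03
  -- The neighbours of vertex 0 are 5 and 8: modulo `I 0`, `m0` reduces to `I 5` and `m4` to `I 8`,
  -- and these two are coprime. For `k1` the neighbours are 5 and 7, and `m3` replaces `m0`.
  have k0 : I 0 + (m4 + (m0 + m3)) = 1 := by
    have f0 : I 0 + m0 = I 0 + I 5 := by
      rw [show m0 = I 5 * (I 1 * I 2 * I 3 * I 4 * I 6 * I 7) by rw [hm0]; ring]
      exact coprime_add_mul (C (C (C (C (C h01 h02) h03) h04) h06) h07) (hone _)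
    have f4 : I 0 + m4 = I 0 + I 8 := by
      rw [show m4 = I 8 * (I 6 * I 7) by rw [hm4]; ring]
      exact coprime_add_mul (C h06 h07) (hone _)
    calc I 0 + (m4 + (m0 + m3)) = (I 0 + m4) + m0 + m3 := by ring
      _ = (I 0 + m0) + I 8 + m3 := by rw [f4]; ring
      _ = (I 5 + I 8) + (I 0 + m3) := by rw [f0]; ring
      _ = 1 := by rw [h58, ← add_assoc, add_comm 1 (I 0), hone, add_comm, e3]
  have k1 : I 1 + (m4 + (m0 + m3)) = 1 := by
    have f3 : I 1 + m3 = I 1 + I 5 := by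
      rw [show m3 = I 5 * (I 0 * I 2 * I 3 * I 4 * I 6 * I 8) by rw [hm3]; ring]
      exact coprime_add_mul (C (C (C (C (C (by rwa [add_comm]) h12) h13) h14) h16) h18)
        (hone _)
    have f4 : I 1 + m4 = I 1 + I 7 := by
      rw [show m4 = I 7 * (I 6 * I 8) by rw [hm4]; ring]
      exact coprime_add_mul (C h16 h18) (hone _)
    calc I 1 + (m4 + (m0 + m3)) = (I 1 + m4) + m0 + m3 := by ring
      _ = (I 1 + m3) + I 7 + m0 := by rw [f4]; ring
      _ = (I 5 + I 7) + (I 1 + m0) := by rw [f3]; ring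
      _ = 1 := by rw [h57, ← add_assoc, add_comm 1 (I 1), hone, add_comm, e0]
  rw [add_comm] at k0 k1 k2 k3 k5
  have key : (m4 + (m0 + m3)) + I 0 ^ 2 * I 1 ^ 2 * I 2 ^ 2 * I 3 * I 5 ^ 3 = 1 := by
    rw [pow_two, pow_two, pow_two, pow_succ, pow_two]
    exact C (C (C (C (C k0 k0) (C k1 k1)) (C k2 k2)) k3) (C (C k5 k5) k5)
  have e2 : I 0 * I 1 * I 2 ^ 2 * I 3 ^ 2 * I 4 ^ 2 * I 5 ^ 2 * I 6 + 1 = 1 :=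
    hmul (hmul (hmul (hmul (hmul (hmul (hone _) (hone _)) (hpow (hone _))) (hpow (hone _)))
      (hpow (hone _))) (hpow (hone _))) (hone _)
  calc _ = I 0 * I 1 * I 2 ^ 2 * I 3 ^ 2 * I 4 ^ 2 * I 5 ^ 2 * I 6 +
        ((m4 + (m0 + m3)) + I 0 ^ 2 * I 1 ^ 2 * I 2 ^ 2 * I 3 * I 5 ^ 3) := by ring
    _ = 1 := by rw [key, e2]

theorem torusCoord_eq (d : Fin 6 → F) (p : Fin 9 → F) :
    torusCoord d p = ![d 5 * p 0, d 4 * p 1, d 1 / d 2 * p 2, d 2 / d 3 * p 3, d 3 * p 4,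
      d 0 / (d 1 * d 4 * d 5) * p 5, d 0 / (d 1 * d 2 * d 3) * p 6, d 0 / d 4 * p 7,
      d 0 / d 5 * p 8] := by
  funext j
  fin_cases j <;> simp [torusCoord, degree, Fin.prod_univ_six, div_eq_mul_inv] <;>
    (left; ring)

theorem coprime_mul_iff (h1 : (1 : F) + 1 = 1) {a b c : F} (hb : b + 1 = 1) (hc : c + 1 = 1) :
    a + b * c = 1 ↔ a + b = 1 ∧ a + c = 1 :=
  ⟨fun h => ⟨coprime_of_mul_left hb hc h, coprime_of_mul_left hc hb (by rwa [mul_comm])⟩,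
    fun h => coprime_mul h1 h.1 h.2⟩

theorem mul_add_one (h1 : (1 : F) + 1 = 1) {a b : F} (ha : a + 1 = 1) (hb : b + 1 = 1) :
    a * b + 1 = 1 := by
  rw [add_comm] at *
  exact coprime_mul h1 ha hb

/-- Read `p + a = a` as "`a` divides `p`": two coprime divisors have a product that divides. -/
theorem add_mul_eq_of_coprime {p a b : F} (ha : p + a = a) (hb : p + b = b) (h : a + b = 1) :
    p + a * b = a * b := by
  calc p + a * b = p * (a + b) + a * b := by rw [h, mul_one]
    _ = p * a + (p + a) * b := by ring
    _ = (p + b) * a := by rw [ha]; ring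
    _ = a * b := by rw [hb, mul_comm]

/-- These combinations are chosen so that, in torus coordinates, clearing the denominator of each
one solves for a single `d i`. -/
theorem GraphCoprime.blowup_relations {I : Fin 9 → F} (h1 : (1 : F) + 1 = 1)
    (hI : GraphCoprime I) :
    I 1 + I 0 * I 8 = 1 ∧ I 7 + I 0 * I 2 * I 3 * I 4 * I 5 = 1 ∧
      I 8 + I 1 * I 2 * I 3 * I 4 * I 5 = 1 ∧ I 0 * I 1 * I 5 + I 3 * I 4 * I 4 * I 6 = 1 ∧
      I 2 + I 4 * I 6 = 1 ∧ I 3 + I 6 = 1 := by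
  have C := @coprime_mul F _ h1
  obtain ⟨⟨h01, h02, h03, h04, h06, h07⟩, ⟨h12, h13, h14, h16, h18⟩, ⟨h24, h26, h27, h28⟩,
      ⟨h35, h36, h37, h38⟩, ⟨h45, h47, h48⟩, ⟨h56, h57, h58⟩⟩ := graphCoprime_iff.mp hI
  refine ⟨C (by rwa [add_comm]) h18, ?_, ?_, ?_, C h24 h26, h36⟩
  · rw [add_comm] at h07 h27 h37 h47 h57
    exact C (C (C (C h07 h27) h37) h47) h57
  · rw [add_comm] at h18 h28 h38 h48 h58
    exact C (C (C (C h18 h28) h38) h48) h58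
  · have a0 : I 0 + I 3 * I 4 * I 4 * I 6 = 1 := C (C (C h03 h04) h04) h06
    have a1 : I 1 + I 3 * I 4 * I 4 * I 6 = 1 := C (C (C h13 h14) h14) h16
    have a5 : I 5 + I 3 * I 4 * I 4 * I 6 = 1 := by
      rw [add_comm] at h35 h45
      exact C (C (C h35 h45) h45) h56
    rw [add_comm] at a0 a1 a5 ⊢
    exact C (C a0 a1) a5

/-- For integral elements, coprimality to a product splits into coprimality to its factors. In torus
coordinates `I 2 * I 3 * I 4` is `d 1`, so the three extra hypotheses say that `d 1`, `d 4`, `d 5`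
are pairwise coprime. -/
theorem graphCoprime_of_blowup_relations {I : Fin 9 → F} (h1 : (1 : F) + 1 = 1)
    (hone : ∀ j, I j + 1 = 1)
    (h01 : I 0 + I 1 = 1) (h0J : I 0 + I 2 * I 3 * I 4 = 1) (h1J : I 1 + I 2 * I 3 * I 4 = 1)
    (h7 : I 7 + I 0 * I 2 * I 3 * I 4 * I 5 = 1) (h8 : I 8 + I 1 * I 2 * I 3 * I 4 * I 5 = 1)
    (h : I 0 * I 1 * I 5 + I 3 * I 4 * I 4 * I 6 = 1)
    (h2 : I 2 + I 4 * I 6 = 1) (h36 : I 3 + I 6 = 1) : GraphCoprime I := by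
  have m := @mul_add_one F _ h1
  have E := @coprime_mul_iff F _ h1
  have o0 := hone 0
  have o1 := hone 1
  have o2 := hone 2
  have o3 := hone 3
  have o4 := hone 4
  have o5 := hone 5
  have o6 := hone 6
  obtain ⟨h24, h26⟩ := (E o4 o6).mp h2
  obtain ⟨q, h04⟩ := (E (m o2 o3) o4).mp h0J
  obtain ⟨h02, h03⟩ := (E o2 o3).mp q
  obtain ⟨q, h14⟩ := (E (m o2 o3) o4).mp h1J
  obtain ⟨h12, h13⟩ := (E o2 o3).mp q
  obtain ⟨q, h75⟩ := (E (m (m (m o0 o2) o3) o4) o5).mp h7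
  obtain ⟨q, h74⟩ := (E (m (m o0 o2) o3) o4).mp q
  obtain ⟨q, h73⟩ := (E (m o0 o2) o3).mp q
  obtain ⟨h70, h72⟩ := (E o0 o2).mp q
  obtain ⟨q, h85⟩ := (E (m (m (m o1 o2) o3) o4) o5).mp h8
  obtain ⟨q, h84⟩ := (E (m (m o1 o2) o3) o4).mp q
  obtain ⟨q, h83⟩ := (E (m o1 o2) o3).mp q
  obtain ⟨h81, h82⟩ := (E o1 o2).mp q
  obtain ⟨q, h6⟩ := (E (m (m o3 o4) o4) o6).mp h
  obtain ⟨q, h4⟩ := (E (m o3 o4) o4).mp q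
  obtain ⟨h3, -⟩ := (E o3 o4).mp q
  rw [add_comm] at h3 h4 h6
  obtain ⟨q, h65⟩ := (E (m o0 o1) o5).mp h6
  obtain ⟨h60, h61⟩ := (E o0 o1).mp q
  obtain ⟨-, h45⟩ := (E (m o0 o1) o5).mp h4
  obtain ⟨-, h35⟩ := (E (m o0 o1) o5).mp h3
  rw [add_comm] at h75 h74 h73 h72 h70 h85 h84 h83 h82 h81 h60 h61 h65
  exact graphCoprime_iff.mpr ⟨⟨h01, h02, h03, h04, h60, h70⟩, ⟨h12, h13, h14, h61, h81⟩,
    ⟨h24, h26, h72, h82⟩, ⟨h35, h36, h73, h83⟩, ⟨h45, h74, h84⟩, ⟨h65, h75, h85⟩⟩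

/-- All five monomials have degree `(3,-1,-1,-1,-1,-1)`, so the torus acts on their sum by one
character, which can be divided out. -/
theorem GraphCoprime.sum_torusCoord (h1 : (1 : F) + 1 = 1) {r s t : F} {d : Fin 6 → F}
    (hd : ∀ i, d i ≠ 0)
    (h : GraphCoprime (torusCoord d ![1, 1, 1, 1, 1, 1, r, s, t])) :
    r * s + 1 + r + r * t + r * (s * t) = d 1 * d 2 * d 3 * d 4 * d 5 / d 0 ^ 3 := by
  have e := h.sum_monomials h1
  rw [torusCoord_eq] at e
  have d0 := hd 0
  have d1 := hd 1
  have d2 := hd 2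
  have d3 := hd 3
  have d4 := hd 4
  have d5 := hd 5
  simp only [Matrix.cons_val, mul_one] at e
  generalize d 0 = P at *
  generalize d 1 = J at *
  generalize d 2 = L at *
  generalize d 3 = M at *
  generalize d 4 = A at *
  generalize d 5 = B at *
  clear h hd
  have := congrArg (J * L * M * A * B / P ^ 3 * ·) e
  simp only [mul_one] at this
  rw [← this, mul_add, mul_add, mul_add, mul_add]
  congr 1
  · congr 1
    · congr 1
      · congr 1
        · field_simp
        · field_simp
      · field_simp
    · field_simp
  · field_simp

/-- The torus element with coprime coordinates is determined by the point of the surface. -/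
theorem eq_of_graphCoprime (h1 : (1 : F) + 1 = 1) {r s t : F} {d : Fin 6 → F}
    (hd : ∀ i, d i ≠ 0)
    (h : GraphCoprime (torusCoord d ![1, 1, 1, 1, 1, 1, r, s, t])) :
    d 0 = (1 + s + t)⁻¹ ∧ d 4 = d 0 * (1 + s) ∧ d 5 = d 0 * (1 + t) ∧ d 1 = d 0 * (1 + r) ∧
      d 2 = d 1 + d 0 * r / d 1 ∧ d 3 = d 2 + d 0 * r / (d 1 * d 2) := by
  obtain ⟨e1, e2, e3, e4, e5, e6⟩ := h.blowup_relations h1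
  rw [torusCoord_eq] at e1 e2 e3 e4 e5 e6
  have d0 := hd 0
  have d1 := hd 1
  have d2 := hd 2
  have d3 := hd 3
  have d4 := hd 4
  have d5 := hd 5
  simp only [Matrix.cons_val, mul_one] at e1 e2 e3 e4 e5 e6
  generalize d 0 = P at *
  generalize d 1 = J at *
  generalize d 2 = L at *
  generalize d 3 = M at *
  generalize d 4 = A at *
  generalize d 5 = B at *
  clear h hd
  have k1 : A = P * (1 + s) := by
    have := congrArg (A * ·) e2
    simp only [mul_one] at this
    rw [← this]; field_simp; ring
  refine ⟨?_, k1, ?_, ?_, ?_, ?_⟩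
  · apply eq_inv_of_mul_eq_one_left
    rw [mul_add, ← k1, ← e1]; field_simp
  · have := congrArg (B * ·) e3
    simp only [mul_one] at this
    rw [← this]; field_simp; ring
  · have := congrArg (J * ·) e4
    simp only [mul_one] at this
    rw [← this]; field_simp
  · have := congrArg (L * ·) e5
    simp only [mul_one] at this
    rw [← this]; field_simp
  · have := congrArg (M * ·) e6
    simp only [mul_one] at this
    rw [← this]; field_simp

/-- Existence of a torus element with coprime coordinates. -/
theorem exists_graphCoprime (h1 : (1 : F) + 1 = 1) {r s t : F}
    (hrs : r + s = s + t) (hrt : r + t = s + t) :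
    ∃ d : Fin 6 → F, (∀ i, d i ≠ 0) ∧
      GraphCoprime (torusCoord d ![1, 1, 1, 1, 1, 1, r, s, t]) := by
  have nz := @add_ne_zero_of_idem F _ h1
  have dup := add_self_of_idem h1
  have C := @coprime_mul F _ h1
  have hu : 1 + s + t ≠ 0 := by rw [add_assoc]; exact nz one_ne_zero _
  -- The values are forced by the formulas in `eq_of_graphCoprime`; `Z` and `W` below are the
  -- corrections with `L = J + Z` and `M = L + W`.
  obtain ⟨P, hP⟩ : ∃ P, P = (1 + s + t)⁻¹ := ⟨_, rfl⟩
  have P0 : P ≠ 0 := hP ▸ inv_ne_zero hu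
  have hPu : P * (1 + s + t) = 1 := by rw [hP, inv_mul_cancel₀ hu]
  obtain ⟨A, hA⟩ : ∃ A, A = P + P * s := ⟨_, rfl⟩
  obtain ⟨B, hB⟩ : ∃ B, B = P + P * t := ⟨_, rfl⟩
  obtain ⟨J, hJ⟩ : ∃ J, J = P + P * r := ⟨_, rfl⟩
  have A0 : A ≠ 0 := hA ▸ nz P0 _
  have B0 : B ≠ 0 := hB ▸ nz P0 _
  have J0 : J ≠ 0 := hJ ▸ nz P0 _
  obtain ⟨Z, hZ⟩ : ∃ Z, Z = P * r / J := ⟨_, rfl⟩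
  have hZ' : P * r = Z * J := by rw [hZ]; field_simp
  obtain ⟨L, hL⟩ : ∃ L, L = J + Z := ⟨_, rfl⟩
  have L0 : L ≠ 0 := hL ▸ nz J0 _
  obtain ⟨W, hW⟩ : ∃ W, W = Z / L := ⟨_, rfl⟩
  have hW' : Z = W * L := by rw [hW]; field_simp
  obtain ⟨M, hM⟩ : ∃ M, M = L + W := ⟨_, rfl⟩
  have M0 : M ≠ 0 := hM ▸ nz L0 _
  have dupl : ∀ a b : F, a + (a + b) = a + b := fun a b => by rw [← add_assoc, dup]
  have dupr : ∀ a b : F, b + (a + b) = a + b := fun a b => by rw [add_left_comm, dup]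
  have AB : A + B = 1 := by
    rw [← hPu, hA, hB]
    calc P + P * s + (P + P * t) = (P + P) + P * s + P * t := by ring
      _ = _ := by rw [dup]; ring
  -- This and `BJ` are where `hrs` and `hrt` enter: any two of `r`, `s`, `t` generate the same ideal
  -- as `s`, `t`.
  have AJ : A + J = 1 := by
    rw [← hPu, hA, hJ]
    calc P + P * s + (P + P * r) = (P + P) + P * (r + s) := by ring
      _ = _ := by rw [dup, hrs]; ring
  have BJ : B + J = 1 := by
    rw [← hPu, hB, hJ]
    calc P + P * t + (P + P * r) = (P + P) + P * (r + t) := by ring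
      _ = _ := by rw [dup, hrt]; ring
  have PA : P + A = A := by rw [hA, dupl]
  have PB : P + B = B := by rw [hB, dupl]
  have PJ : P + J = J := by rw [hJ, dupl]
  have J1 : J + 1 = 1 := add_one_of_add_eq_one h1 (add_comm A J ▸ AJ)
  have Z1 : Z + 1 = 1 := by
    refine mul_right_cancel₀ J0 ?_
    rw [add_mul, one_mul, ← hZ', hJ, dupr]
  have L1 : L + 1 = 1 := by rw [hL, add_assoc, Z1, J1]
  have W1 : W + 1 = 1 := by
    refine mul_right_cancel₀ L0 ?_
    rw [add_mul, one_mul, ← hW', hL, dupr]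
  have M1 : M + 1 = 1 := by rw [hM, add_assoc, W1, L1]
  -- `A`, `B`, `J` divide `P` and are pairwise coprime, so the sixth coordinate `P / (J * A * B)` is
  -- integral.
  have PAB : P + A * B * J = A * B * J := by
    refine add_mul_eq_of_coprime (add_mul_eq_of_coprime PA PB AB) PJ ?_
    rw [add_comm]
    exact C (add_comm A J ▸ AJ) (add_comm B J ▸ BJ)
  refine ⟨![P, J, L, M, A, B], ?_, ?_⟩
  · intro i; fin_cases i <;> assumption
  have hI := torusCoord_eq ![P, J, L, M, A, B] ![1, 1, 1, 1, 1, 1, r, s, t]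
  simp only [Matrix.cons_val, mul_one] at hI
  rw [hI]
  have dv : ∀ {a b : F}, b ≠ 0 → a + b = b → a / b + 1 = 1 := fun {a b} hb h => by
    rw [← div_self hb, ← add_div, h]
  have hr6 : P / (J * L * M) * r = W / M := by
    rw [hW, hZ]; field_simp
  rw [hr6]
  refine graphCoprime_of_blowup_relations h1 ?_ ?_ ?_ ?_ ?_ ?_ ?_ ?_ ?_
  · intro j
    fin_cases j <;> simp only [Matrix.cons_val, Fin.reduceFinMk]
    · exact add_one_of_add_eq_one h1 (add_comm A B ▸ AB)
    · exact add_one_of_add_eq_one h1 AB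
    · exact dv L0 (by rw [hL, dupl])
    · exact dv M0 (by rw [hM, dupl])
    · exact M1
    · refine dv (mul_ne_zero (mul_ne_zero J0 A0) B0) ?_
      rw [show J * A * B = A * B * J by ring, PAB]
    · exact dv M0 (by rw [hM, dupr])
    · rw [div_mul_eq_mul_div]
      exact dv A0 (by rw [hA, dupr])
    · rw [div_mul_eq_mul_div]
      exact dv B0 (by rw [hB, dupr])
  all_goals simp only [Matrix.cons_val]
  · rw [add_comm, AB]
  · rw [show J / L * (L / M) * M = J by field_simp, BJ]
  · rw [show J / L * (L / M) * M = J by field_simp, AJ]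
  · have : P / A * s + B * (J / L) * (L / M) * M * (P / (J * A * B)) = (P + P * s) / A := by
      field_simp; ring
    rw [this, ← hA, div_self A0]
  · have : P / B * t + A * (J / L) * (L / M) * M * (P / (J * A * B)) = (P + P * t) / B := by
      field_simp; ring
    rw [this, ← hB, div_self B0]
  · have : B * A * (P / (J * A * B)) + L / M * M * M * (W / M) = (P + W * L * J) / J := by
      field_simp
    rw [this, ← hW', ← hZ', ← hJ, div_self J0]
  · have : J / L + M * (W / M) = (J + W * L) / L := by field_simp
    rw [this, ← hW', ← hL, div_self L0]
  · rw [← add_div, ← hM, div_self M0]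

end Idempotent

/-! ### Parametrization of the torsor -/

section Parametrization

variable {K : Type*} [Field K]

/-- The point of the torsor over the point `(s : -1 / (s + t) : 1 : t : s * t)` of the surface
determined by the element `z` of the torus. -/
def torsorParam (z : Fin 6 → K) (s t : K) : Fin 9 → K :=
  torusCoord z ![1, 1, 1, 1, 1, 1, -(s + t), s, t]

theorem torsorParam_eq (z : Fin 6 → K) (s t : K) :
    torsorParam z s t = ![z 5, z 4, z 1 / z 2, z 2 / z 3, z 3,
      z 0 / (z 1 * z 4 * z 5), z 0 / (z 1 * z 2 * z 3) * (-(s + t)), z 0 / z 4 * s,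
      z 0 / z 5 * t] := by
  rw [torsorParam, torusCoord_eq]
  simp

theorem torsorParam_mem {z : Fin 6 → K} (hz : ∀ i, z i ≠ 0) {s t : K} (hst : s + t ≠ 0) :
    torsorParam z s t ∈ torsorSpace K := by
  intro j hj
  have h0 := hz 0
  have h1 := hz 1
  have h2 := hz 2
  have h3 := hz 3
  have h4 := hz 4
  have h5 := hz 5
  have hst' : -(s + t) ≠ 0 := neg_ne_zero.mpr hst
  rw [torsorParam_eq]
  fin_cases j <;> first
    | exact absurd hj (by decide)
    | (simp only [Matrix.cons_val, Fin.reduceFinMk]; first | assumption | positivity)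

theorem torsorParam_torsorEquation {z : Fin 6 → K} (hz : ∀ i, z i ≠ 0) (s t : K) :
    TorsorEquation (torsorParam z s t) := by
  have h0 := hz 0
  have h1 := hz 1
  have h2 := hz 2
  have h3 := hz 3
  have h4 := hz 4
  have h5 := hz 5
  rw [TorsorEquation, torsorParam_eq]
  simp only [Matrix.cons_val]
  field_simp
  ring

theorem exists_eq_torsorParam {a : Fin 9 → K} (ha : a ∈ torsorSpace K) (h : TorsorEquation a) :
    ∃ (z : Fin 6 → K) (s t : K), (∀ i, z i ≠ 0) ∧ s + t ≠ 0 ∧ a = torsorParam z s t := by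
  have h0 : a 0 ≠ 0 := ha 0 (by decide)
  have h1 : a 1 ≠ 0 := ha 1 (by decide)
  have h2 : a 2 ≠ 0 := ha 2 (by decide)
  have h3 : a 3 ≠ 0 := ha 3 (by decide)
  have h4 : a 4 ≠ 0 := ha 4 (by decide)
  have h5 : a 5 ≠ 0 := ha 5 (by decide)
  have h6 : a 6 ≠ 0 := ha 6 (by decide)
  unfold TorsorEquation at h
  have hst : a 7 / (a 0 * a 2 * a 3 * a 4 * a 5) + a 8 / (a 1 * a 2 * a 3 * a 4 * a 5) =
      - (a 3 * a 4 ^ 2 * a 6 / (a 0 * a 1 * a 5)) := by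
    field_simp
    linear_combination h
  -- The first six degrees form a basis of `ℤ ^ 6`; these monomials in the first six coordinates
  -- invert it.
  refine ⟨![a 0 * a 1 * a 2 * a 3 * a 4 * a 5, a 2 * a 3 * a 4, a 3 * a 4, a 4, a 1, a 0],
    a 7 / (a 0 * a 2 * a 3 * a 4 * a 5), a 8 / (a 1 * a 2 * a 3 * a 4 * a 5), ?_, ?_, ?_⟩
  · intro i
    fin_cases i <;> simp [*]
  · rw [hst]
    simp [*]
  · rw [torsorParam_eq, hst]
    funext j
    fin_cases j <;> simp <;> field_simp

theorem torsorParam_injective {z z' : Fin 6 → K} {s t s' t' : K}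
    (hz' : ∀ i, z' i ≠ 0) (h : torsorParam z s t = torsorParam z' s' t') :
    z = z' ∧ s = s' ∧ t = t' := by
  rw [torsorParam_eq, torsorParam_eq] at h
  have e := fun j => congrFun h j
  have e0 : z 5 = z' 5 := e 0
  have e1 : z 4 = z' 4 := e 1
  have e2 : z 1 / z 2 = z' 1 / z' 2 := e 2
  have e3 : z 2 / z 3 = z' 2 / z' 3 := e 3
  have e4 : z 3 = z' 3 := e 4
  have e5 : z 0 / (z 1 * z 4 * z 5) = z' 0 / (z' 1 * z' 4 * z' 5) := e 5
  have e7 : z 0 / z 4 * s = z' 0 / z' 4 * s' := e 7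
  have e8 : z 0 / z 5 * t = z' 0 / z' 5 * t' := e 8
  rw [e4, div_left_inj' (hz' 3)] at e3
  rw [e3, div_left_inj' (hz' 2)] at e2
  rw [e0, e1, e2, div_left_inj' (mul_ne_zero (mul_ne_zero (hz' 1) (hz' 4)) (hz' 5))] at e5
  rw [e5, e1, mul_right_inj' (div_ne_zero (hz' 0) (hz' 4))] at e7
  rw [e5, e0, mul_right_inj' (div_ne_zero (hz' 0) (hz' 5))] at e8
  refine ⟨?_, e7, e8⟩
  funext i
  fin_cases i <;> assumption

theorem unitAction_torsorParam [NumberField K] (u : Fin 6 → (𝓞 K)ˣ) (z : Fin 6 → K) (s t : K) :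
    unitAction u (torsorParam z s t) = torsorParam (fun i => ((u i : 𝓞 K) : K) * z i) s t := by
  funext j
  simp only [unitAction, torsorParam, torusCoord, mul_zpow, Finset.prod_mul_distrib]
  rw [← mul_assoc]
  congr 2
  simp [Fin.prod_univ_six, NumberField.Units.coe_zpow]

theorem fractionalIdeal_one_add_one : (1 : FractionalIdeal (𝓞 K)⁰ K) + 1 = 1 := by
  rw [← FractionalIdeal.sup_eq_add, sup_idem]

end Parametrization

/-! ### Fractional ideals and class representatives -/

section Ideals

variable {K : Type*} [Field K] [NumberField K]

open FractionalIdeal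

theorem spanSingleton_neg_eq (x : K) : FractionalIdeal.spanSingleton (𝓞 K)⁰ (-x) =
    FractionalIdeal.spanSingleton (𝓞 K)⁰ x :=
  (FractionalIdeal.spanSingleton_eq_spanSingleton (R := 𝓞 K)).mpr ⟨-1, by simp⟩

variable (K) in
/-- The principal fractional ideal generated by an element, as a homomorphism. -/
noncomputable def spanSingletonHom : K →*₀ FractionalIdeal (𝓞 K)⁰ K where
  toFun := spanSingleton (𝓞 K)⁰
  map_zero' := by simp
  map_one' := by simp
  map_mul' := by simp

/-- This moves coprimality into the semifield of fractional ideals, where the sign of `-(s + t)`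
disappears and the torus element is `(z i) / c i`. -/
theorem coordIdeal_torsorParam (c : Fin 6 → (Ideal (𝓞 K))⁰) (z : Fin 6 → K) (s t : K) :
    coordIdeal c (torsorParam z s t) =
      torusCoord (fun i => spanSingleton (𝓞 K)⁰ (z i) / (((c i : Ideal (𝓞 K)) :
        FractionalIdeal (𝓞 K)⁰ K)))
        ![1, 1, 1, 1, 1, 1, spanSingleton (𝓞 K)⁰ (s + t), spanSingleton (𝓞 K)⁰ s,
          spanSingleton (𝓞 K)⁰ t] := by
  have hz : ∀ (x : K) (n : ℤ), spanSingleton (𝓞 K)⁰ (x ^ n) = spanSingleton (𝓞 K)⁰ x ^ n :=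
    map_zpow₀ (spanSingletonHom K)
  have hp : ∀ j, spanSingleton (𝓞 K)⁰ ((![1, 1, 1, 1, 1, 1, -(s + t), s, t] : Fin 9 → K) j) =
      ![1, 1, 1, 1, 1, 1, spanSingleton (𝓞 K)⁰ (s + t), spanSingleton (𝓞 K)⁰ s,
          spanSingleton (𝓞 K)⁰ t] j := by
    intro j
    fin_cases j <;> simp [spanSingleton_neg_eq, -neg_add_rev]
  funext j
  rw [coordIdeal, torsorParam, torusCoord, torusCoord, ← hp, idealPow]
  simp only [Fin.prod_univ_six, ← spanSingleton_mul_spanSingleton, hz, div_zpow]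
  simp only [div_eq_mul_inv, mul_inv]
  ring

theorem spanSingleton_add_le (x y : K) :
    spanSingleton (𝓞 K)⁰ (x + y) ≤ spanSingleton (𝓞 K)⁰ x + spanSingleton (𝓞 K)⁰ y := by
  rw [spanSingleton_le_iff_mem, mem_add]
  exact ⟨x, mem_spanSingleton_self _ x, y, mem_spanSingleton_self _ y, rfl⟩

/-- Supplies the two hypotheses on `r`, `s`, `t` in `exists_graphCoprime`, with `r` the ideal of `s
+ t`. -/
theorem spanSingleton_add_add_spanSingleton (x y : K) :
    spanSingleton (𝓞 K)⁰ (x + y) + spanSingleton (𝓞 K)⁰ x =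
      spanSingleton (𝓞 K)⁰ x + spanSingleton (𝓞 K)⁰ y := by
  have h1 := spanSingleton_add_le x y
  have h2 := spanSingleton_add_le (x + y) (-x)
  rw [add_neg_cancel_comm, spanSingleton_neg_eq] at h2
  rw [← sup_eq_add, ← sup_eq_add] at *
  exact le_antisymm (sup_le h1 le_sup_left) (sup_le le_sup_right h2)

/-- There is exactly one way, up to units, to write a nonzero fractional ideal as a principal one
divided by a representative of an ideal class. -/
theorem exists_class_representative {𝒞 : Finset ((Ideal (𝓞 K))⁰)}
    (h𝒞 : Set.BijOn (fun I : (Ideal (𝓞 K))⁰ => ClassGroup.mk0 I) (𝒞 : Set ((Ideal (𝓞 K))⁰))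
      Set.univ)
    {d : FractionalIdeal (𝓞 K)⁰ K} (hd : d ≠ 0) :
    ∃ c ∈ 𝒞, ∃ z : K, z ≠ 0 ∧ ∀ c' ∈ 𝒞, ∀ z' : K,
      (z' ≠ 0 ∧ spanSingleton (𝓞 K)⁰ z' / ((c' : Ideal (𝓞 K)) : FractionalIdeal (𝓞 K)⁰ K) = d ↔
        c' = c ∧ ∃ u : (𝓞 K)ˣ, z' = ((u : 𝓞 K) : K) * z) := by
  -- The inverse is used because `(z) / c = d` puts `c` in the ideal class of `d⁻¹`.
  obtain ⟨x, I, hx, hI⟩ := exists_eq_spanSingleton_mul d⁻¹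
  have hcne : ∀ c : (Ideal (𝓞 K))⁰, ((c : Ideal (𝓞 K)) : FractionalIdeal (𝓞 K)⁰ K) ≠ 0 :=
    fun c => coeIdeal_ne_zero.mpr (nonZeroDivisors.coe_ne_zero c)
  have hI0 : I ≠ 0 := by
    rintro rfl
    simp [hd] at hI
  have hx0 : (algebraMap (𝓞 K) K x)⁻¹ ≠ 0 := by simpa using hx
  set y := (algebraMap (𝓞 K) K x)⁻¹
  set I' : (Ideal (𝓞 K))⁰ := ⟨I, mem_nonZeroDivisors_of_ne_zero hI0⟩
  have key : ∀ (c : (Ideal (𝓞 K))⁰) (z : K),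
      spanSingleton (𝓞 K)⁰ z / ((c : Ideal (𝓞 K)) : FractionalIdeal (𝓞 K)⁰ K) = d ↔
      spanSingleton (𝓞 K)⁰ (z * y) * ((I' : Ideal (𝓞 K)) : FractionalIdeal (𝓞 K)⁰ K) = c := by
    intro c z
    rw [← spanSingleton_mul_spanSingleton, mul_assoc, ← hI, ← div_eq_mul_inv,
      div_eq_iff (hcne c), div_eq_iff hd, mul_comm]
  obtain ⟨c, hc, hcI⟩ := h𝒞.surjOn (Set.mem_univ (ClassGroup.mk0 I'))
  obtain ⟨w, hw0, hw⟩ := (ClassGroup.mk0_eq_mk0_iff_exists_fraction_ring K).mp hcI.symm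
  refine ⟨c, hc, w / y, div_ne_zero hw0 hx0, fun c' hc' z' => ?_⟩
  rw [key]
  constructor
  · rintro ⟨hz', h⟩
    have : ClassGroup.mk0 I' = ClassGroup.mk0 c' :=
      (ClassGroup.mk0_eq_mk0_iff_exists_fraction_ring K).mpr ⟨z' * y, mul_ne_zero hz' hx0, h⟩
    have hcc : c' = c := h𝒞.injOn hc' hc (this.symm.trans hcI.symm)
    refine ⟨hcc, ?_⟩
    subst hcc
    have h2 := mul_right_cancel₀ (hcne I') (h.trans hw.symm)
    obtain ⟨u, hu⟩ := (spanSingleton_eq_spanSingleton (R := 𝓞 K)).mp h2.symm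
    refine ⟨u, ?_⟩
    rw [← mul_div_assoc, eq_div_iff hx0, ← hu]
    rfl
  · rintro ⟨rfl, u, rfl⟩
    refine ⟨mul_ne_zero (by simp) (div_ne_zero hw0 hx0), ?_⟩
    rw [← hw]
    congr 1
    refine ((spanSingleton_eq_spanSingleton (R := 𝓞 K)).mpr ⟨u, ?_⟩).symm
    rw [mul_assoc, div_mul_cancel₀ _ hx0]
    rfl

/-- Above each point of the open subset, the coprime torsor points form a single orbit of the
units, for a single tuple of class representatives. -/
theorem exists_torsor_orbit {𝒞 : Finset ((Ideal (𝓞 K))⁰)}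
    (h𝒞 : Set.BijOn (fun I : (Ideal (𝓞 K))⁰ => ClassGroup.mk0 I) (𝒞 : Set ((Ideal (𝓞 K))⁰))
      Set.univ) (s t : K) :
    ∃ c ∈ Fintype.piFinset (fun _ : Fin 6 => 𝒞), ∃ z : Fin 6 → K, (∀ i, z i ≠ 0) ∧
      ∀ c' ∈ Fintype.piFinset (fun _ : Fin 6 => 𝒞), ∀ z' : Fin 6 → K,
        ((∀ i, z' i ≠ 0) ∧ Coprimality c' (torsorParam z' s t) ↔
          c' = c ∧ ∃ u : Fin 6 → (𝓞 K)ˣ, z' = fun i => ((u i : 𝓞 K) : K) * z i) := by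
  have h1 := fractionalIdeal_one_add_one (K := K)
  have hcne : ∀ c : (Ideal (𝓞 K))⁰, ((c : Ideal (𝓞 K)) : FractionalIdeal (𝓞 K)⁰ K) ≠ 0 :=
    fun c => coeIdeal_ne_zero.mpr (nonZeroDivisors.coe_ne_zero c)
  obtain ⟨d, hd, hcop⟩ := exists_graphCoprime h1 (spanSingleton_add_add_spanSingleton s t)
    (show spanSingleton (𝓞 K)⁰ (s + t) + spanSingleton (𝓞 K)⁰ t = _ by
      rw [add_comm s t, spanSingleton_add_add_spanSingleton, add_comm])
  choose c hc z hz hcz using fun i => exists_class_representative h𝒞 (hd i)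
  refine ⟨c, Fintype.mem_piFinset.mpr hc, z, hz, fun c' hc' z' => ?_⟩
  -- By uniqueness of the coprime torus element, coprimality decouples into six independent
  -- conditions `(z' i) / c' i = d i`.
  have hiff : (∀ i, z' i ≠ 0) ∧ Coprimality c' (torsorParam z' s t) ↔
      ∀ i, z' i ≠ 0 ∧ spanSingleton (𝓞 K)⁰ (z' i) /
        ((c' i : Ideal (𝓞 K)) : FractionalIdeal (𝓞 K)⁰ K) = d i := by
    rw [forall_and]
    refine and_congr_right fun hz' => ?_
    have hne : ∀ i, spanSingleton (𝓞 K)⁰ (z' i) /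
        ((c' i : Ideal (𝓞 K)) : FractionalIdeal (𝓞 K)⁰ K) ≠ 0 :=
      fun i => div_ne_zero (spanSingleton_ne_zero_iff.mpr (hz' i)) (hcne _)
    change GraphCoprime (coordIdeal c' (torsorParam z' s t)) ↔ _
    rw [coordIdeal_torsorParam]
    constructor
    · intro h
      obtain ⟨e0, e4, e5, e1, e2, e3⟩ := eq_of_graphCoprime h1 hne h
      obtain ⟨f0, f4, f5, f1, f2, f3⟩ := eq_of_graphCoprime h1 hd hcop
      have g0 := e0.trans f0.symm
      have g1 := e1.trans (g0 ▸ f1.symm)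
      have g2 := e2.trans (show _ = d 2 by rw [g0, g1, ← f2])
      have g3 := e3.trans (show _ = d 3 by rw [g0, g1, g2, ← f3])
      have g4 := e4.trans (g0 ▸ f4.symm)
      have g5 := e5.trans (g0 ▸ f5.symm)
      intro i
      fin_cases i <;> assumption
    · intro h
      rw [funext h]
      exact hcop
  rw [hiff, forall_congr' fun i => hcz i (c' i) (Fintype.mem_piFinset.mp hc' i) (z' i), forall_and,
    funext_iff]
  refine and_congr_right fun _ => ?_
  rw [Classical.skolem]
  simp only [funext_iff]

end Ideals

/-! ### The height condition -/

section Height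

variable {K : Type*} [Field K]

/-- Coordinates of a point of the surface with third coordinate one. -/
def surfacePoint (s t : K) : Fin 5 → K := ![s, -(s + t)⁻¹, 1, t, s * t]

theorem surfacePoint_ne_zero (s t : K) : surfacePoint s t ≠ 0 := fun h =>
  one_ne_zero (congrFun h 2)

/-- The signs in the last two forms come from the torsor equation, which replaces `a_2 a_8 + a_3
a_4^2 a_5^3 a_7` by `-a_1 a_9`. -/
theorem heightForms_torsorParam {z : Fin 6 → K} (hz : ∀ i, z i ≠ 0) {s t : K} (hst : s + t ≠ 0) :
    heightForms (fun j : Fin 8 => torsorParam z s t j.castSucc) =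
      fun i => (![1, 1, 1, -1, -1] : Fin 5 → K) i *
        (-(s + t) * z 0 ^ 3 / (z 1 * z 2 * z 3 * z 4 * z 5)) * surfacePoint s t i := by
  have h0 := hz 0
  have h1 := hz 1
  have h2 := hz 2
  have h3 := hz 3
  have h4 := hz 4
  have h5 := hz 5
  funext i
  rw [torsorParam_eq]
  fin_cases i <;> simp [heightForms, surfacePoint] <;> field_simp <;> ring

variable [NumberField K]

open FractionalIdeal NumberField

/-- The height in terms of the infinite places and the norm of the ideal generated by the
coordinates. -/
theorem mulHeight_mul_absNorm {ι : Type*} [Fintype ι] {x : ι → K} (hx : x ≠ 0) :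
    Height.mulHeight x * (absNorm (∑ i, spanSingleton (𝓞 K)⁰ (x i)) : ℝ) =
      ∏ v : InfinitePlace K, (⨆ i, v (x i)) ^ v.mult := by
  -- For integral coordinates the finite places multiply to the inverse norm of the generated ideal.
  -- Clearing the denominator `b` scales both the ideal norm and the infinite part by `|N(b)|`.
  obtain ⟨b, hb⟩ := IsLocalization.exist_integer_multiples_of_finite (𝓞 K)⁰ x
  choose y hy using hb
  have hb0 : ((b : 𝓞 K) : K) ≠ 0 := by simp
  have hy' : (fun i => ((y i : 𝓞 K) : K)) = ((b : 𝓞 K) : K) • x := funext fun i => by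
    rw [Pi.smul_apply, smul_eq_mul]
    exact (hy i).trans (Algebra.smul_def _ _)
  have hyx : ∀ i, ((y i : 𝓞 K) : K) = ((b : 𝓞 K) : K) * x i := fun i => congrFun hy' i
  have hyK : (fun i => ((y i : 𝓞 K) : K)) ≠ 0 := hy' ▸ smul_ne_zero hb0 hx
  have hy0 : y ≠ 0 := by
    rintro rfl
    exact hyK (by funext i; simp)
  have hfin := absNorm_mul_finprod_finitePlace_eq_one hy0
  have hspan : ((Ideal.span (Set.range y) : Ideal (𝓞 K)) : FractionalIdeal (𝓞 K)⁰ K) =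
      spanSingleton (𝓞 K)⁰ ((b : 𝓞 K) : K) * ∑ i, spanSingleton (𝓞 K)⁰ (x i) := by
    have : Ideal.span (Set.range y) = ∑ i, Ideal.span {y i} := by
      rw [Ideal.span_range_eq_iSup, Ideal.sum_eq_sup, Finset.sup_univ_eq_iSup]
    rw [this, Finset.mul_sum]
    have h := map_sum (coeIdealHom (𝓞 K)⁰ K) (fun i => Ideal.span {y i}) Finset.univ
    simp only [coeIdealHom_apply] at h
    rw [h]
    refine Finset.sum_congr rfl fun i _ => ?_
    rw [coeIdeal_span_singleton, spanSingleton_mul_spanSingleton]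
    exact congrArg _ (hyx i)
  have hnorm : (Ideal.absNorm (Ideal.span (Set.range y)) : ℝ) =
      (|Algebra.norm ℚ ((b : 𝓞 K) : K)| : ℚ) *
        (absNorm (∑ i, spanSingleton (𝓞 K)⁰ (x i)) : ℝ) := by
    rw [← Rat.cast_mul, ← absNorm_span_singleton (𝓞 K), ← map_mul, ← hspan, coeIdeal_absNorm]
    simp
  have hinf : ∏ v : InfinitePlace K, (⨆ i, v ((y i : 𝓞 K) : K)) ^ v.mult =
      (|Algebra.norm ℚ ((b : 𝓞 K) : K)| : ℚ) *
        ∏ v : InfinitePlace K, (⨆ i, v (x i)) ^ v.mult := by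
    rw [← InfinitePlace.prod_eq_abs_norm, ← Finset.prod_mul_distrib]
    refine Finset.prod_congr rfl fun v _ => ?_
    rw [← mul_pow, Real.mul_iSup_of_nonneg (apply_nonneg v _)]
    simp only [hyx, map_mul]
  have hH : Height.mulHeight x =
      (∏ v : InfinitePlace K, (⨆ i, v ((y i : 𝓞 K) : K)) ^ v.mult) *
        ∏ᶠ v : FinitePlace K, ⨆ i, v ((y i : 𝓞 K) : K) := by
    rw [← mulHeight_eq hyK, hy', Height.mulHeight_smul_eq_mulHeight _ hb0]
  rw [hnorm] at hfin
  rw [hH, hinf]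
  linear_combination (∏ v : InfinitePlace K, (⨆ i, v (x i)) ^ v.mult) * hfin

/-- Up to sign the scaled coordinates are the five monomials in the `a_j`. Dividing each `a_j` by
`𝒪_j` makes them generate the unit ideal, and their common degree gives the right-hand side. -/
theorem sum_spanSingleton_surfacePoint {c : Fin 6 → (Ideal (𝓞 K))⁰} {z : Fin 6 → K}
    (hz : ∀ i, z i ≠ 0) {s t : K} (hst : s + t ≠ 0) (hcop : Coprimality c (torsorParam z s t)) :
    ∑ i, spanSingleton (𝓞 K)⁰
      ((-(s + t) * z 0 ^ 3 / (z 1 * z 2 * z 3 * z 4 * z 5)) * surfacePoint s t i) =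
      idealPow K c ![3, -1, -1, -1, -1, -1] := by
  have h0 := hz 0
  have h1 := hz 1
  have h2 := hz 2
  have h3 := hz 3
  have h4 := hz 4
  have h5 := hz 5
  have hcne : ∀ i, ((c i : Ideal (𝓞 K)) : FractionalIdeal (𝓞 K)⁰ K) ≠ 0 :=
    fun i => coeIdeal_ne_zero.mpr (nonZeroDivisors.coe_ne_zero (c i))
  have hφ : ∀ x : K, spanSingleton (𝓞 K)⁰ x = spanSingletonHom K x := fun _ => rfl
  have hneg : ∀ x : K, spanSingletonHom K (-x) = spanSingletonHom K x := spanSingleton_neg_eq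
  have z0 := (map_ne_zero (spanSingletonHom K)).mpr h0
  have z1 := (map_ne_zero (spanSingletonHom K)).mpr h1
  have z2 := (map_ne_zero (spanSingletonHom K)).mpr h2
  have z3 := (map_ne_zero (spanSingletonHom K)).mpr h3
  have z4 := (map_ne_zero (spanSingletonHom K)).mpr h4
  have z5 := (map_ne_zero (spanSingletonHom K)).mpr h5
  have r0 := (map_ne_zero (spanSingletonHom K)).mpr hst
  have c0 := hcne 0
  have c1 := hcne 1
  have c2 := hcne 2
  have c3 := hcne 3
  have c4 := hcne 4
  have c5 := hcne 5
  change GraphCoprime (coordIdeal c (torsorParam z s t)) at hcop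
  rw [coordIdeal_torsorParam] at hcop
  have hsum := hcop.sum_torusCoord fractionalIdeal_one_add_one
    fun i => div_ne_zero ((map_ne_zero (spanSingletonHom K)).mpr (hz i)) (hcne i)
  simp only [hφ] at hsum
  simp only [hφ, map_mul, ← Finset.mul_sum]
  have hsum' : ∑ i, spanSingletonHom K (surfacePoint s t i) =
      (spanSingletonHom K (s + t))⁻¹ * (spanSingletonHom K (s + t) * spanSingletonHom K s + 1 +
        spanSingletonHom K (s + t) + spanSingletonHom K (s + t) * spanSingletonHom K t +
        spanSingletonHom K (s + t) * (spanSingletonHom K s * spanSingletonHom K t)) := by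
    simp only [Fin.sum_univ_five, surfacePoint, Matrix.cons_val, map_mul, hneg, map_inv₀, map_one]
    field_simp
  rw [hsum', hsum, idealPow]
  simp only [Fin.prod_univ_six, Matrix.cons_val, map_mul,
    map_div₀, map_pow, hneg, zpow_neg, zpow_one]
  rw [show (3 : ℤ) = ((3 : ℕ) : ℤ) from rfl, zpow_natCast]
  field_simp

theorem heightCondition_iff {c : Fin 6 → (Ideal (𝓞 K))⁰} {z : Fin 6 → K}
    (hz : ∀ i, z i ≠ 0) {s t : K} (hst : s + t ≠ 0) (hcop : Coprimality c (torsorParam z s t))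
    (B : ℝ) :
    HeightCondition c B (torsorParam z s t) ↔ Height.mulHeight (surfacePoint s t) ≤ B := by
  have h0 := hz 0
  have h1 := hz 1
  have h2 := hz 2
  have h3 := hz 3
  have h4 := hz 4
  have h5 := hz 5
  set w : K := -(s + t) * z 0 ^ 3 / (z 1 * z 2 * z 3 * z 4 * z 5)
  have hw : w ≠ 0 := div_ne_zero (mul_ne_zero (neg_ne_zero.mpr hst) (pow_ne_zero _ h0))
    (mul_ne_zero (mul_ne_zero (mul_ne_zero (mul_ne_zero h1 h2) h3) h4) h5)
  have hT : ∀ v : InfinitePlace K, nTilde v (fun j : Fin 8 => torsorParam z s t j.castSucc) =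
      (⨆ i, v ((w • surfacePoint s t) i)) ^ v.mult := by
    intro v
    rw [nTilde, Real.iSup_pow fun i => apply_nonneg v _, heightForms_torsorParam hz hst]
    congr 1
    funext i
    congr 1
    have : v ((![1, 1, 1, -1, -1] : Fin 5 → K) i) = 1 := by
      fin_cases i <;> simp [InfinitePlace.coe_apply]
    rw [map_mul, map_mul, this, one_mul, Pi.smul_apply, smul_eq_mul, map_mul]
  have hne : w • surfacePoint s t ≠ 0 := smul_ne_zero hw (surfacePoint_ne_zero s t)
  have hprod := mulHeight_mul_absNorm hne
  simp only [Pi.smul_apply, smul_eq_mul] at hprod hT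
  rw [sum_spanSingleton_surfacePoint hz hst hcop, Height.mulHeight_smul_eq_mulHeight _ hw] at hprod
  have hpos : 0 < (uNorm c : ℝ) := by
    rw [Rat.cast_pos, uNorm]
    refine lt_of_le_of_ne (absNorm_nonneg _) (Ne.symm ?_)
    rw [Ne, absNorm_eq_zero_iff, idealPow]
    exact Finset.prod_ne_zero_iff.mpr fun i _ => zpow_ne_zero _
      (coeIdeal_ne_zero.mpr (nonZeroDivisors.coe_ne_zero (c i)))
  rw [HeightCondition, Finset.prod_congr rfl fun v _ => hT v, ← hprod, mul_comm]
  exact mul_le_mul_iff_right₀ hpos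

end Height

/-! ### Lines on the surface and points of the open subset -/

section Points

variable {K : Type*} [Field K]

theorem isLineInSurface_span {i : Fin 5} (hi : i = 0 ∨ i = 1 ∨ i = 3) :
    IsLineInSurface (Submodule.span K (Set.range fun k : Fin 2 =>
      Pi.basisFun K (Fin 5) (![i, 4] k))) := by
  constructor
  · have hinj : Function.Injective (![i, 4] : Fin 2 → Fin 5) := by
      rcases hi with rfl | rfl | rfl <;> decide
    exact finrank_span_eq_card ((Pi.basisFun K (Fin 5)).linearIndependent.comp _ hinj)
  · intro w hw
    obtain ⟨c, rfl⟩ := (Submodule.mem_span_range_iff_exists_fun K).mp hw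
    rcases hi with rfl | rfl | rfl <;> simp [OnSurface, Fin.sum_univ_two]

theorem mem_span_of_eq_zero {x : Fin 5 → K} {i : Fin 5} (hi : i ≠ 4)
    (h : ∀ j, j ≠ i → j ≠ 4 → x j = 0) :
    x ∈ Submodule.span K (Set.range fun k : Fin 2 => Pi.basisFun K (Fin 5) (![i, 4] k)) := by
  refine (Submodule.mem_span_range_iff_exists_fun K).mpr ⟨![x i, x 4], ?_⟩
  funext j
  by_cases hji : j = i
  · subst hji; simp [Fin.sum_univ_two, hi]
  · by_cases hj4 : j = 4
    · subst hj4; simp [Fin.sum_univ_two, Ne.symm hi]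
    · simp [Fin.sum_univ_two, hji, hj4, h j hji hj4]

/-- A line meets the hyperplane `x_2 = 0` in some `q ≠ 0`. If `p` on the line had `p 2 ≠ 0`, the two
quadrics and their polar forms at `p`, `q` would force `q = 0`. -/
theorem apply_two_eq_zero_of_mem_line {W : Submodule K (Fin 5 → K)} (hW : IsLineInSurface W)
    {p : Fin 5 → K} (hp : p ∈ W) : p 2 = 0 := by
  by_contra hp2
  obtain ⟨hfr, hS⟩ := hW
  obtain ⟨q, hqW, hq0, hq2⟩ : ∃ q ∈ W, q ≠ 0 ∧ q 2 = 0 := by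
    by_contra! hno
    have hinj : Function.Injective ((LinearMap.proj 2 : (Fin 5 → K) →ₗ[K] K).domRestrict W) := by
      rw [← LinearMap.ker_eq_bot, LinearMap.ker_eq_bot']
      rintro ⟨q, hq⟩ h
      by_contra hne
      exact hno q hq (fun h0 => hne (Subtype.ext h0)) h
    have := LinearMap.finrank_le_finrank_of_injective hinj
    rw [hfr, Module.finrank_self] at this
    omega
  obtain ⟨p1, p2⟩ := hS p hp
  obtain ⟨q1, q2⟩ := hS q hqW
  obtain ⟨r1, r2⟩ := hS (p + q) (W.add_mem hp hqW)
  simp only [Pi.add_apply, hq2] at r1 r2 q1 q2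
  -- Polarization: the equations at `p + q` minus those at `p` and at `q`.
  have b1 : p 0 * q 3 + q 0 * p 3 = p 2 * q 4 := by linear_combination r1 - p1 - q1
  have b2 : p 1 * (q 0 + q 3) + q 1 * (p 0 + p 3) = 0 := by linear_combination r2 - p2 - q2
  have hp13 : p 1 * (p 0 + p 3) ≠ 0 := by
    rw [show p 1 * (p 0 + p 3) = -(p 2 ^ 2) by linear_combination p2]
    exact neg_ne_zero.mpr (pow_ne_zero 2 hp2)
  have hq03 : q 0 + q 3 = 0 := by
    by_contra hne
    have hq1 : q 1 = 0 := by
      have : q 1 * (q 0 + q 3) = 0 := by linear_combination q2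
      exact (mul_eq_zero.mp this).resolve_right hne
    rw [hq1, zero_mul, add_zero] at b2
    exact (mul_ne_zero (left_ne_zero_of_mul hp13) hne) b2
  have hq1 : q 1 = 0 := by
    rw [hq03, mul_zero, zero_add] at b2
    exact (mul_eq_zero.mp b2).resolve_right (right_ne_zero_of_mul hp13)
  have hq0' : q 0 = 0 := by
    have : q 0 ^ 2 = 0 := by linear_combination q 0 * hq03 - q1
    exact pow_eq_zero_iff (two_ne_zero) |>.mp this
  have hq3 : q 3 = 0 := by rw [hq0', zero_add] at hq03; exact hq03
  have hq4 : q 4 = 0 := by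
    rw [hq3, hq0', mul_zero, zero_mul, add_zero] at b1
    exact (mul_eq_zero.mp b1.symm).resolve_left hp2
  apply hq0
  funext j
  fin_cases j <;> assumption

/-- If `x_2 = 0`, the equations leave at most one of `x_0`, `x_1`, `x_3` nonzero, so the point lies
on one of three coordinate lines through `(0:0:0:0:1)`. Conversely, no line leaves `x_2 = 0`. -/
theorem mem_pointsU_iff (P : Projectivization K (Fin 5 → K)) :
    P ∈ pointsU K ↔ OnSurface P.rep ∧ P.rep 2 ≠ 0 := by
  refine and_congr_right fun hS => ⟨fun h h2 => ?_, fun h2 W hW hmem => h2 ?_⟩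
  · obtain ⟨e1, e2⟩ := hS
    have h03 : P.rep 0 = 0 ∨ P.rep 3 = 0 := by simpa [h2] using e1
    have h1 : P.rep 1 = 0 ∨ P.rep 0 + P.rep 3 = 0 := by
      rw [← mul_eq_zero]
      linear_combination e2 - P.rep 2 * h2
    have key : ∀ i : Fin 5, (i = 0 ∨ i = 1 ∨ i = 3) → ¬ (∀ j, j ≠ i → j ≠ 4 → P.rep j = 0) :=
      fun i hi hj => h _ (isLineInSurface_span hi)
        (mem_span_of_eq_zero (by rcases hi with rfl | rfl | rfl <;> decide)
          fun j h h' => by simp [hj j h h'])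
    by_cases hr0 : P.rep 0 = 0
    · by_cases hr1 : P.rep 1 = 0
      · refine key 3 (by simp) fun j h h' => ?_
        fin_cases j <;> simp_all
      · refine key 1 (by simp) fun j h h' => ?_
        fin_cases j <;> simp_all
    · refine key 0 (by simp) fun j h h' => ?_
      fin_cases j <;> simp_all
  · have := apply_two_eq_zero_of_mem_line hW hmem
    simpa using this

theorem onSurface_surfacePoint {s t : K} (hst : s + t ≠ 0) : OnSurface (surfacePoint s t) := by
  constructor
  · simp [surfacePoint]
  · simp only [surfacePoint, Matrix.cons_val]
    field_simp
    ring

theorem mk_surfacePoint_injective {s t s' t' : K}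
    (h : Projectivization.mk K (surfacePoint s t) (surfacePoint_ne_zero s t) =
      Projectivization.mk K (surfacePoint s' t') (surfacePoint_ne_zero s' t')) :
    s = s' ∧ t = t' := by
  obtain ⟨a, ha⟩ := (Projectivization.mk_eq_mk_iff' K _ _ _ _).mp h
  have h2 : a * 1 = 1 := congrFun ha 2
  rw [mul_one] at h2
  subst h2
  rw [one_smul] at ha
  exact ⟨(congrFun ha 0).symm, (congrFun ha 3).symm⟩

theorem mk_surfacePoint_mem {s t : K} (hst : s + t ≠ 0) :
    Projectivization.mk K (surfacePoint s t) (surfacePoint_ne_zero s t) ∈ pointsU K := by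
  rw [mem_pointsU_iff]
  obtain ⟨a, ha⟩ := Projectivization.exists_smul_eq_mk_rep K (surfacePoint s t)
    (surfacePoint_ne_zero s t)
  rw [← ha]
  obtain ⟨h1, h2⟩ := onSurface_surfacePoint hst
  refine ⟨⟨?_, ?_⟩, ?_⟩
  · simp only [Pi.smul_apply, Units.smul_def, smul_eq_mul]
    linear_combination (a : K) ^ 2 * h1
  · simp only [Pi.smul_apply, Units.smul_def, smul_eq_mul]
    linear_combination (a : K) ^ 2 * h2
  · simp [surfacePoint, Units.smul_def]

theorem exists_eq_mk_surfacePoint {P : Projectivization K (Fin 5 → K)} (hP : P ∈ pointsU K) :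
    ∃ s t : K, s + t ≠ 0 ∧
      P = Projectivization.mk K (surfacePoint s t) (surfacePoint_ne_zero s t) := by
  obtain ⟨⟨h1, h2⟩, h3⟩ := (mem_pointsU_iff P).mp hP
  have hprod : P.rep 1 * (P.rep 0 + P.rep 3) = -(P.rep 2 ^ 2) := by linear_combination h2
  have hne : P.rep 1 * (P.rep 0 + P.rep 3) ≠ 0 := hprod ▸ neg_ne_zero.mpr (pow_ne_zero 2 h3)
  have hsum := right_ne_zero_of_mul hne
  refine ⟨P.rep 0 / P.rep 2, P.rep 3 / P.rep 2, ?_, ?_⟩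
  · rw [← add_div]
    exact div_ne_zero hsum h3
  · conv_lhs => rw [← P.mk_rep]
    rw [Projectivization.mk_eq_mk_iff']
    refine ⟨P.rep 2, ?_⟩
    funext j
    fin_cases j
    · simp [surfacePoint]; field_simp
    · simp only [surfacePoint, Pi.smul_apply, smul_eq_mul, ← add_div]
      simp
      field_simp
      linear_combination -hprod
    · simp [surfacePoint]
    · simp [surfacePoint]; field_simp
    · simp [surfacePoint]; field_simp
      linear_combination h1

variable [NumberField K]

/-- The parameters of the points of bounded height in the open subset. -/
def boundedParams (K : Type*) [Field K] [NumberField K] (B : ℝ) : Set (K × K) :=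
  {p | p.1 + p.2 ≠ 0 ∧ Height.mulHeight (surfacePoint p.1 p.2) ≤ B}

/-- Northcott: since the third coordinate is 1, the heights of `s` and `t` are at most that of the
point. -/
theorem boundedParams_finite (B : ℝ) : (boundedParams K B).Finite := by
  have hfin := NumberField.finite_setOfPred_mulHeight₁_le (K := K) B
  have hle : ∀ (i : Fin 5) (x : Fin 5 → K), x 2 = 1 →
      Height.mulHeight₁ (x i) ≤ Height.mulHeight x := by
    intro i x hx
    have h := Height.mulHeight_comp_le ![i, 2] x
    rw [Height.mulHeight₁_eq_mulHeight]
    convert h using 2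
    funext k
    fin_cases k <;> simp [hx]
  refine (hfin.prod hfin).subset fun p hp => ?_
  exact ⟨(hle 0 (surfacePoint p.1 p.2) rfl).trans hp.2,
    (hle 3 (surfacePoint p.1 p.2) rfl).trans hp.2⟩

theorem bijOn_boundedPointsU (B : ℝ) :
    Set.BijOn (fun p : K × K => Projectivization.mk K (surfacePoint p.1 p.2)
      (surfacePoint_ne_zero p.1 p.2)) (boundedParams K B) (boundedPointsU K B) := by
  refine ⟨fun p hp => ⟨mk_surfacePoint_mem hp.1, ?_⟩, fun p _ q _ h => ?_, fun P hP => ?_⟩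
  · rw [Projectivization.mulHeight_mk]
    exact hp.2
  · exact Prod.ext_iff.mpr (mk_surfacePoint_injective h)
  · obtain ⟨s, t, hst, rfl⟩ := exists_eq_mk_surfacePoint hP.1
    exact ⟨(s, t), ⟨hst, by simpa [Projectivization.mulHeight_mk] using hP.2⟩, rfl⟩

end Points

/-! ### Unit orbits and the count -/

section Counting

variable {K : Type*} [Field K]

open NumberField

theorem unitAction_mul (u v : Fin 6 → (𝓞 K)ˣ) (a : Fin 9 → K) :
    unitAction u (unitAction v a) = unitAction (u * v) a := by
  funext j
  simp only [unitAction, Pi.mul_apply, mul_zpow, Finset.prod_mul_distrib]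
  push_cast
  ring

theorem unitAction_mem {u : Fin 6 → (𝓞 K)ˣ} {a : Fin 9 → K} (ha : a ∈ torsorSpace K) :
    unitAction u a ∈ torsorSpace K :=
  fun j hj => mul_ne_zero (Units.coe_ne_zero _) (ha j hj)

variable [NumberField K]

theorem IsFundamentalSystem.exists_eq_mul {ε : Fin (Units.rank K) → (𝓞 K)ˣ}
    (hε : IsFundamentalSystem ε) (u : (𝓞 K)ˣ) :
    ∃ ζ : Units.torsion K, ∃ v ∈ Subgroup.closure (Set.range ε), u = v * (ζ : (𝓞 K)ˣ) := by
  obtain ⟨⟨ζ, n⟩, h, -⟩ := hε u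
  exact ⟨ζ, _, Subgroup.mem_closure_range_iff_of_fintype.mpr ⟨n, rfl⟩, by rw [h, mul_comm]⟩

theorem IsFundamentalSystem.torsion_eq {ε : Fin (Units.rank K) → (𝓞 K)ˣ}
    (hε : IsFundamentalSystem ε) {ζ ζ' : Units.torsion K} {v v' : (𝓞 K)ˣ}
    (hv : v ∈ Subgroup.closure (Set.range ε)) (hv' : v' ∈ Subgroup.closure (Set.range ε))
    (h : v * (ζ : (𝓞 K)ˣ) = v' * (ζ' : (𝓞 K)ˣ)) : ζ = ζ' := by
  obtain ⟨n, rfl⟩ := Subgroup.mem_closure_range_iff_of_fintype.mp hv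
  obtain ⟨n', rfl⟩ := Subgroup.mem_closure_range_iff_of_fintype.mp hv'
  exact congrArg Prod.fst ((hε _).unique (y₁ := (ζ, n)) (y₂ := (ζ', n')) (mul_comm _ _)
    (h.trans (mul_comm _ _)))

/-- The membership conditions in `torsorPoints` are automatic, since coprimality forces integrality.
-/
theorem Coprimality.mem_idealPow {c : Fin 6 → (Ideal (𝓞 K))⁰} {a : Fin 9 → K}
    (h : Coprimality c a) (j : Fin 9) : a j ∈ idealPow K c (degree j) := by
  have h1 := GraphCoprime.add_one (I := coordIdeal c a) fractionalIdeal_one_add_one h j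
  have hne : idealPow K c (degree j) ≠ 0 := Finset.prod_ne_zero_iff.mpr fun i _ =>
    zpow_ne_zero _ (FractionalIdeal.coeIdeal_ne_zero.mpr (nonZeroDivisors.coe_ne_zero (c i)))
  rw [← FractionalIdeal.sup_eq_add, sup_eq_right, coordIdeal] at h1
  have h2 := mul_le_mul_left h1 (idealPow K c (degree j))
  rw [inv_mul_cancel_right₀ hne, one_mul, FractionalIdeal.spanSingleton_le_iff_mem] at h2
  exact h2

/-- The points of `M_c(B)` correspond to pairs of a point of bounded height whose class
representatives are `c` and a root of unity. -/
theorem exists_bijOn_torsorPoints {ε : Fin (Units.rank K) → (𝓞 K)ˣ}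
    (hε : IsFundamentalSystem ε) {𝒞 : Finset ((Ideal (𝓞 K))⁰)}
    (h𝒞 : Set.BijOn (fun I : (Ideal (𝓞 K))⁰ => ClassGroup.mk0 I) (𝒞 : Set ((Ideal (𝓞 K))⁰))
      Set.univ)
    {D : Set (Fin 9 → K)} (hD : IsFundamentalDomain (Subgroup.closure (Set.range ε)) D) (B : ℝ) :
    ∃ (γ : K × K → Fin 6 → (Ideal (𝓞 K))⁰) (β : (K × K) × Units.torsion K → Fin 9 → K),
      (∀ p, γ p ∈ Fintype.piFinset (fun _ : Fin 6 => 𝒞)) ∧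
      ∀ c ∈ Fintype.piFinset (fun _ : Fin 6 => 𝒞),
        Set.BijOn β ({p ∈ boundedParams K B | γ p = c} ×ˢ Set.univ) (torsorPoints D c B) := by
  choose γ hγ z hz hγz using fun p : K × K => exists_torsor_orbit h𝒞 p.1 p.2
  obtain ⟨hDsub, hDu⟩ := hD
  -- `b` is the representative in `D` of the orbit of the base point twisted by the root of unity.
  -- The twist is in the factor `0`, the only one restricted to fundamental units. The value at `s +
  -- t = 0` is a dummy.
  have hex : ∀ q : (K × K) × Units.torsion K, ∃ b : Fin 9 → K, q.1.1 + q.1.2 ≠ 0 →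
      (b ∈ D ∧ ∃ u : Fin 6 → (𝓞 K)ˣ, u 0 ∈ Subgroup.closure (Set.range ε) ∧
        b = unitAction u (unitAction (Pi.mulSingle 0 (q.2 : (𝓞 K)ˣ))
          (torsorParam (z q.1) q.1.1 q.1.2))) ∧
      ∀ b' ∈ D, ∀ u : Fin 6 → (𝓞 K)ˣ, u 0 ∈ Subgroup.closure (Set.range ε) →
        b' = unitAction u (unitAction (Pi.mulSingle 0 (q.2 : (𝓞 K)ˣ))
          (torsorParam (z q.1) q.1.1 q.1.2)) → b' = b := by
    intro q
    by_cases hq : q.1.1 + q.1.2 = 0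
    · exact ⟨0, fun h => absurd hq h⟩
    · obtain ⟨b, hb, hb'⟩ := hDu _ (unitAction_mem (u := Pi.mulSingle 0 (q.2 : (𝓞 K)ˣ))
        (torsorParam_mem (hz q.1) hq))
      exact ⟨b, fun _ => ⟨hb, fun b' h1 u h2 h3 => hb' b' ⟨h1, u, h2, h3⟩⟩⟩
  choose β hβ using hex
  refine ⟨γ, β, hγ, fun c hc => ⟨?_, ?_, ?_⟩⟩
  · rintro ⟨p, ζ⟩ ⟨⟨⟨hp, hB⟩, rfl⟩, -⟩
    obtain ⟨⟨hbD, u, -, hu⟩, -⟩ := hβ (p, ζ) hp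
    rw [unitAction_mul, unitAction_torsorParam] at hu
    obtain ⟨hne, hcop⟩ := (hγz p (γ p) hc _).mpr ⟨rfl, u * Pi.mulSingle 0 (ζ : (𝓞 K)ˣ), rfl⟩
    have hh := (heightCondition_iff hne hp hcop B).mpr hB
    rw [← hu] at hcop hh
    refine ⟨hcop.mem_idealPow, hDsub hbD, hbD, hh, ?_, hcop⟩
    rw [hu]
    exact torsorParam_torsorEquation hne _ _
  · rintro ⟨p, ζ⟩ ⟨⟨⟨hp, -⟩, -⟩, -⟩ ⟨p', ζ'⟩ ⟨⟨⟨hp', -⟩, -⟩, -⟩ h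
    obtain ⟨⟨-, u, hu0, hu⟩, -⟩ := hβ (p, ζ) hp
    obtain ⟨⟨-, u', hu0', hu'⟩, -⟩ := hβ (p', ζ') hp'
    rw [h, hu', unitAction_mul, unitAction_mul, unitAction_torsorParam, unitAction_torsorParam]
      at hu
    -- Freeness of the action: equal images have equal `(s, t)` and equal total units, so the
    -- torsion parts agree.
    obtain ⟨hzz, hs, ht⟩ := torsorParam_injective
      (fun i => mul_ne_zero (Units.coe_ne_zero _) (hz p i)) hu
    obtain rfl : p' = p := Prod.ext hs ht
    have h0 := mul_right_cancel₀ (hz p' 0) (congrFun hzz 0)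
    have h1 : u' 0 * (ζ' : (𝓞 K)ˣ) = u 0 * (ζ : (𝓞 K)ˣ) := by
      have := Units.coe_injective K h0
      simpa using this
    rw [hε.torsion_eq hu0 hu0' h1.symm]
  · rintro a ⟨-, hane, haD, hah, hat, hac⟩
    obtain ⟨w, s, t, hw, hst, rfl⟩ := exists_eq_torsorParam hane hat
    obtain ⟨rfl, u, rfl⟩ := (hγz (s, t) c hc w).mp ⟨hw, hac⟩
    obtain ⟨ζ, v, hv, hu0⟩ := hε.exists_eq_mul (u 0)
    refine ⟨((s, t), ζ), ⟨⟨⟨hst, (heightCondition_iff hw hst hac B).mp hah⟩, rfl⟩, trivial⟩, ?_⟩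
    -- The torsion part of `u 0` is moved into the twist, so the remaining unit tuple lies in the
    -- acting group.
    refine ((hβ ((s, t), ζ) hst).2 _ haD (Function.update u 0 v) (by simpa using hv) ?_).symm
    rw [unitAction_mul, unitAction_torsorParam]
    have : Function.update u 0 v * Pi.mulSingle 0 (ζ : (𝓞 K)ˣ) = u := by
      funext i
      by_cases hi : i = 0
      · subst hi; simp [hu0]
      · simp [hi]
    rw [this]

end Counting

end A3A1

theorem lemma4p3 (K : Type*) [Field K] [NumberField K]
    (ε : Fin (NumberField.Units.rank K) → (𝓞 K)ˣ) (hε : A3A1.IsFundamentalSystem ε)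
    (𝒞 : Finset ((Ideal (𝓞 K))⁰))
    (h𝒞 : Set.BijOn (fun I : (Ideal (𝓞 K))⁰ => ClassGroup.mk0 I) (𝒞 : Set ((Ideal (𝓞 K))⁰)) Set.univ)
    (D : Set (Fin 9 → K))
    (hD : A3A1.IsFundamentalDomain (Subgroup.closure (Set.range ε)) D)
    (B : ℝ) :
    (A3A1.boundedPointsU K B).Finite ∧
    (∀ c ∈ Fintype.piFinset (fun _ : Fin 6 => 𝒞), (A3A1.torsorPoints D c B).Finite) ∧
    (A3A1.countingFunction K B : ℝ) =
      1 / (Nat.card (NumberField.Units.torsion K) : ℝ) *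
        ∑ c ∈ Fintype.piFinset (fun _ : Fin 6 => 𝒞), ((A3A1.torsorPoints D c B).ncard : ℝ) := by
  classical
  obtain ⟨γ, β, hγ, hβ⟩ := A3A1.exists_bijOn_torsorPoints hε h𝒞 hD B
  have hfin := A3A1.boundedParams_finite (K := K) B
  have hbij := A3A1.bijOn_boundedPointsU (K := K) B
  refine ⟨hbij.image_eq ▸ hfin.image _, fun c hc => ?_, ?_⟩
  · rw [← (hβ c hc).image_eq]
    exact ((hfin.subset (Set.sep_subset _ _)).prod Set.finite_univ).image _
  -- Each `M_c(B)` has `|μ_K|` elements per point in the fibre of `γ` over `c`; the fibres partition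
  -- the points of bounded height.
  · have hcard : ∀ c ∈ Fintype.piFinset (fun _ : Fin 6 => 𝒞),
        ((A3A1.torsorPoints D c B).ncard : ℝ) =
          ((hfin.toFinset.filter fun p => γ p = c).card : ℝ) *
            (Nat.card (NumberField.Units.torsion K) : ℝ) := by
      intro c hc
      rw [← (hβ c hc).image_eq, (hβ c hc).injOn.ncard_image, Set.ncard_prod, Set.ncard_univ,
        Nat.cast_mul]
      congr 2
      rw [← Set.ncard_coe_finset]
      congr 1
      ext p
      simp
    rw [Finset.sum_congr rfl hcard, ← Finset.sum_mul, ← Nat.cast_sum,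
      ← Finset.card_eq_sum_card_fiberwise fun p _ => hγ p, A3A1.countingFunction,
      ← hbij.image_eq, hbij.injOn.ncard_image, Set.ncard_eq_toFinset_card _ hfin]
    have : (Nat.card (NumberField.Units.torsion K) : ℝ) ≠ 0 :=
      Nat.cast_ne_zero.mpr Nat.card_pos.ne'
    field_simp
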